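/- Let $\mathbb G$ be a homogeneous group: a finite dimensional real linear space $\mathbb G=H^1\oplus\cdots\oplus H^\iota$ ($H^\iota\neq\{0\}$) with a Lie product satisfying $[H^i,H^j]\subset H^{i+j}$ (where $H^k=\{0\}$ for $k>\iota$), with the group operation given by the Baker–Campbell–Hausdorff formula $xy=x+y+\frac12[x,y]+\cdots$, and with the dilations $\delta_r$, $r>0$, the linear maps with $\delta_r v=r^iv$ for $v\in H^i$. Let $\mathrm{Lie}(\mathbb G)$ be the Lie algebra of left invariant vector fields, $\mathcal V_j=\{X\in\mathrm{Lie}(\mathbb G):X(0)\in H^j\}$, and $H_p\mathbb G=\{X(p):X\in\mathcal V_1\}$. Let $(e_1,\dots,e_q)$ be a graded basis of $\mathbb G$ (each $e_i$ lies in some layer $H^{d_i}$, with $d_1\le\cdots\le d_q$), let $X_i\in\mathrm{Lie}(\mathbb G)$ satisfy $X_i(0)=e_i$, and let $\pi_M$ be the projection of $\Lambda_n(\mathrm{Lie}(\mathbb G))$ that keeps the components along those $X_{i_1}\wedge\cdots\wedge X_{i_n}$, $i_1<\cdots<i_n$, with $d_{i_1}+\cdots+d_{i_n}=M$. For an $n$-dimensional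 embedded $C^1$ submanifold $\Sigma\subset\mathbb G$ and $p\in\Sigma$, let $\xi_{p,\Sigma}$ be a left invariant $n$-vector field whose value at $p$ is $t_1\wedge\cdots\wedge t_n$ for a basis $(t_i)$ of $T_p\Sigma$, let $d_\Sigma(p)=\max\{M:\pi_M(\xi_{p,\Sigma})\ne0\}$ and $$\mathcal A_p\Sigma=\{X\in\mathrm{Lie}(\mathbb G): X\wedge\pi_{d_\Sigma(p)}(\xi_{p,\Sigma})=0\},\qquad A_p\Sigma=\exp\mathcal A_p\Sigma .$$ The point $p$ is algebraically regular if $\mathcal A_p\Sigma$ is a Lie subalgebra of $\mathrm{Lie}(\mathbb G)$. It is a horizontal point if it is algebraically regular and $A_p\Sigma$ is a horizontal subgroup, that is, a linear subspace of $\mathbb G$ that is invariant under all dilations $\delta_r$, is a Lie subgroup of $\mathbb G$, and is contained in $H^1$. The submanifold $\Sigma$ is horizontal if all of its points are horizontal. Theorem. If $\Sigma\subset\mathbb G$ is an embedded $C^1$ submanifold such that $T_p\Sigma\subset H_p\mathbb G$ for every $p\in\Sigma$, then $\Sigma$ is a horizontal submanifold; in particular, every $A_p\Sigma$ is commutative.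 -/

import Mathlib

open scoped Manifold ContDiff

noncomputable section

/-! ### The Baker-Campbell-Hausdorff series -/

/-- The right-nested iterated product `[a₁, [a₂, [… , aₖ]]]` of a word `a₁ a₂ … aₖ`, with respect
to a bilinear product `B`. -/
def nestedBracket {V : Type*} [AddCommGroup V] [Module ℝ V] (B : V →ₗ[ℝ] V →ₗ[ℝ] V) : List V → V
  | [] => 0
  | [a] => a
  | a :: b :: l => B a (nestedBracket B (b :: l))

/-- The word `x^{r₁} y^{s₁} ⋯ x^{rₙ} y^{sₙ}`. -/
def dynkinWord {V : Type*} (x y : V) (l : List (ℕ × ℕ)) : List V :=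
  l.flatMap fun rs => List.replicate rs.1 x ++ List.replicate rs.2 y

open Classical in
/-- The index set of Dynkin's formula: `n` pairs `(rᵢ, sᵢ)` of natural numbers with `rᵢ + sᵢ > 0`
for each `i` and with total sum `j`. -/
def dynkinIndex (n j : ℕ) : Finset (Fin n → ℕ × ℕ) :=
  (Fintype.piFinset fun _ : Fin n => Finset.range (j + 1) ×ˢ Finset.range (j + 1)).filter
    fun f => (∀ i, 0 < (f i).1 + (f i).2) ∧ ∑ i, ((f i).1 + (f i).2) = j

/-- The homogeneous part `c_j(x, y)` of degree `j` of the Baker-Campbell-Hausdorff series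
(Dynkin's formula), with respect to the Lie product `B`. -/
def bchTerm {V : Type*} [AddCommGroup V] [Module ℝ V] (B : V →ₗ[ℝ] V →ₗ[ℝ] V)
    (j : ℕ) (x y : V) : V :=
  ∑ n ∈ Finset.Icc 1 j, ((-1 : ℝ) ^ (n - 1) / (n : ℝ)) •
    ∑ f ∈ dynkinIndex n j,
      ((j : ℝ) * ∏ i, (((f i).1.factorial : ℝ) * ((f i).2.factorial : ℝ)))⁻¹ •
        nestedBracket B (dynkinWord x y (List.ofFn f))

/-- The Baker-Campbell-Hausdorff series `∑_{j=1}^{N} c_j(x, y)`, truncated at degree `N`. -/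
def bch {V : Type*} [AddCommGroup V] [Module ℝ V] (B : V →ₗ[ℝ] V →ₗ[ℝ] V)
    (N : ℕ) (x y : V) : V :=
  ∑ j ∈ Finset.Icc 1 N, bchTerm B j x y

/-! ### Homogeneous groups -/

/-- A homogeneous group: a finite dimensional real linear space `G`, which is the direct sum of
layers `H¹, …, H^step`, endowed with a graded Lie product and with the group operation given by
the Baker-Campbell-Hausdorff formula. (Every connected and simply connected graded nilpotent Lie
group has this form up to isomorphism. The series stops at the step, since a Lie product of more
than `step` elements vanishes.) -/
structure HomogeneousGroup (G : Type*) [NormedAddCommGroup G] [NormedSpace ℝ G]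
    [FiniteDimensional ℝ G] [Group G] where
  /-- the Lie product on `G` -/
  lie : G →ₗ[ℝ] G →ₗ[ℝ] G
  lie_self : ∀ x, lie x x = 0
  jacobi : ∀ x y z, lie x (lie y z) = lie (lie x y) z + lie y (lie x z)
  /-- the layers `H^j` -/
  layer : ℕ → Submodule ℝ G
  /-- the step of the group -/
  step : ℕ
  layer_zero : layer 0 = ⊥
  layer_of_step_lt : ∀ j, step < j → layer j = ⊥
  layer_step_ne_bot : layer step ≠ ⊥
  isInternal : DirectSum.IsInternal layer
  lie_mem : ∀ i j, ∀ x ∈ layer i, ∀ y ∈ layer j, lie x y ∈ layer (i + j)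
  mul_eq_bch : ∀ x y : G, x * y = bch lie step x y

variable {G : Type*} [NormedAddCommGroup G] [NormedSpace ℝ G] [FiniteDimensional ℝ G] [Group G]

/-- The intrinsic dilation `δ_r`: the linear map that multiplies the layer `H^i` by `r ^ i`. -/
def HomogeneousGroup.dilation (S : HomogeneousGroup G) (r : ℝ) : G →ₗ[ℝ] G :=
  (DirectSum.toModule ℝ ℕ G fun i => r ^ i • (S.layer i).subtype) ∘ₗ
    (LinearEquiv.ofBijective (DirectSum.coeLinearMap S.layer) S.isInternal).symm.toLinearMap

/-- The Lie algebra `Lie(G)` of left invariant vector fields of `G`. A left invariant vector field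
`X` is represented by its value at the unit element, and `mulInvariantVectorField X` is the vector
field itself; the bracket is the Lie bracket of vector fields. All tangent spaces of the linear
space `G` are identified with `G`. -/
abbrev LieG (G : Type*) [NormedAddCommGroup G] [NormedSpace ℝ G] [Group G] : Type _ :=
  GroupLieAlgebra 𝓘(ℝ, G) G

/-- The evaluation `X ↦ X(p)` of left invariant vector fields at `p`. -/
def evalAt (p : G) : LieG G →ₗ[ℝ] G where
  toFun X := mulInvariantVectorField X p
  map_add' X Y := congrFun (mulInvariantVectorField_add X Y) p
  map_smul' c X := congrFun (mulInvariantVectorField_smul c X) p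

/-- The layer `𝒱_j` of `Lie(G)`: the left invariant vector fields whose value at the unit
element is in `H^j`. -/
def HomogeneousGroup.lieLayer (S : HomogeneousGroup G) (j : ℕ) : Submodule ℝ (LieG G) :=
  S.layer j

/-- The horizontal fiber `H_pG = {X(p) : X ∈ 𝒱₁}`. -/
def HomogeneousGroup.horizontalFiber (S : HomogeneousGroup G) (p : G) : Submodule ℝ G :=
  (S.lieLayer 1).map (evalAt p)

/-- `IsExp X a` says that `a = exp X`: there is a one-parameter subgroup of `G` with initial
velocity `X`, whose value at time `1` is `a`. -/
def IsExp (X : LieG G) (a : G) : Prop :=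
  ∃ γ : ℝ → G, (∀ s t, γ (s + t) = γ s * γ t) ∧ HasDerivAt γ (X : G) 0 ∧ γ 1 = a

/-- A homogeneous subgroup: a linear subspace that is invariant under dilations and is a
subgroup of `G` (being a linear subspace, it is then a closed Lie subgroup). -/
def HomogeneousGroup.IsHomogeneousSubgroup (S : HomogeneousGroup G) (A : Set G) : Prop :=
  ∃ W : Submodule ℝ G, (W : Set G) = A ∧ (∀ r : ℝ, 0 < r → ∀ x ∈ W, S.dilation r x ∈ W) ∧
    ∃ K : Subgroup G, (K : Set G) = A

/-- A horizontal subgroup: a homogeneous subgroup contained in the first layer. -/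
def HomogeneousGroup.IsHorizontalSubgroup (S : HomogeneousGroup G) (A : Set G) : Prop :=
  S.IsHomogeneousSubgroup A ∧ A ⊆ S.layer 1

/-- A graded basis `(e_1, …, e_q)` of `G`: a basis that lists, one layer after the other, bases of
the layers; `deg i` is the degree of `e_i`. -/
structure GradedBasis (S : HomogeneousGroup G) (q : ℕ) where
  /-- the basis of the linear space `G` -/
  basis : Module.Basis (Fin q) ℝ G
  /-- the degrees of the basis vectors -/
  deg : Fin q → ℕ
  deg_mono : Monotone deg
  mem_layer : ∀ i, basis i ∈ S.layer (deg i)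

/-- The frame `(X_1, …, X_q)` of left invariant vector fields with value `e_j` at the unit. -/
def GradedBasis.frame {S : HomogeneousGroup G} {q : ℕ} (e : GradedBasis S q) :
    Module.Basis (Fin q) ℝ (LieG G) :=
  e.basis

open Classical in
/-- The `M`-projection `π_M` of left invariant `k`-vector fields: it keeps the components along
those `X_I = X_{i_1} ∧ ⋯ ∧ X_{i_k}` whose degree `d(X_I) = ∑_{i ∈ I} d_i` is `M`. -/
def GradedBasis.proj {S : HomogeneousGroup G} {q : ℕ} (e : GradedBasis S q) {k : ℕ} (M : ℕ)
    (ξ : ⋀[ℝ]^k (LieG G)) : ⋀[ℝ]^k (LieG G) :=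
  ∑ I : Set.powersetCard (Fin q) k,
    if ∑ i ∈ I.1, e.deg i = M then
      (e.frame.exteriorPower k).repr ξ I • e.frame.exteriorPower k I
    else 0

/-! ### Submanifolds -/

/-- `Ψ : Ω → G` is a `C^1` local chart (parametrization) of `Σ`: an immersion of class `C^1` on
the open set `Ω ⊆ ℝⁿ`, which is a homeomorphism onto a relatively open subset of `Σ`. -/
def IsC1Chart (n : ℕ) (Sig : Set G) (Ω : Set (EuclideanSpace ℝ (Fin n)))
    (Ψ : EuclideanSpace ℝ (Fin n) → G) : Prop :=
  IsOpen Ω ∧ ContDiffOn ℝ 1 Ψ Ω ∧ (∀ x ∈ Ω, Function.Injective (fderiv ℝ Ψ x)) ∧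
    Topology.IsEmbedding (Ω.domRestrict Ψ) ∧ ∃ U : Set G, IsOpen U ∧ Ψ '' Ω = Sig ∩ U

/-- `Σ` is an `n`-dimensional embedded `C^1` submanifold of `G`. -/
def IsC1Submanifold (n : ℕ) (Sig : Set G) : Prop :=
  ∀ p ∈ Sig, ∃ (Ω : Set (EuclideanSpace ℝ (Fin n))) (Ψ : EuclideanSpace ℝ (Fin n) → G),
    IsC1Chart n Sig Ω Ψ ∧ p ∈ Ψ '' Ω

/-- The tangent space `T_pΣ`, spanned by the velocities of the curves in `Σ` through `p`. -/
def tangentSpaceAt (Sig : Set G) (p : G) : Submodule ℝ G :=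
  Submodule.span ℝ {v | ∃ γ : ℝ → G, γ 0 = p ∧ (∀ᶠ t in nhds 0, γ t ∈ Sig) ∧ HasDerivAt γ v 0}

/-- `τ` is a tangent `n`-vector of `Σ` at `p`: it is `t_1 ∧ ⋯ ∧ t_n` for a basis `(t_1, …, t_n)`
of `T_pΣ`. -/
def IsTangentMultivector (n : ℕ) (Sig : Set G) (p : G) (τ : ⋀[ℝ]^n G) : Prop :=
  ∃ t : Module.Basis (Fin n) ℝ (tangentSpaceAt Sig p),
    τ = exteriorPower.ιMulti ℝ n fun i => (t i : G)

/-- `ξ` is a left invariant `n`-vector field `ξ_{p,Σ}`: its value at `p` is a tangent `n`-vector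
of `Σ` at `p`. (It is unique up to a nonzero factor.) -/
def IsTangentField (n : ℕ) (Sig : Set G) (p : G) (ξ : ⋀[ℝ]^n (LieG G)) : Prop :=
  IsTangentMultivector n Sig p (exteriorPower.map n (evalAt p) ξ)

/-- The pointwise degree `d_Σ(p) = max {M : π_{p,M}(τ_Σ(p)) ≠ 0}`. -/
def GradedBasis.pointwiseDegree {S : HomogeneousGroup G} {q : ℕ} (e : GradedBasis S q)
    (n : ℕ) (Sig : Set G) (p : G) : ℕ :=
  sSup {M | ∃ ξ : ⋀[ℝ]^n (LieG G), IsTangentField n Sig p ξ ∧ e.proj M ξ ≠ 0}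

/-- The Lie homogeneous tangent space `𝒜_pΣ = {X ∈ Lie(G) : X ∧ π_N(ξ_{p,Σ}) = 0}`, where
`N = d_Σ(p)`. -/
def GradedBasis.lieHTangent {S : HomogeneousGroup G} {q : ℕ} (e : GradedBasis S q)
    (n : ℕ) (Sig : Set G) (p : G) : Submodule ℝ (LieG G) where
  carrier := {X | ∀ ξ : ⋀[ℝ]^n (LieG G), IsTangentField n Sig p ξ →
    ExteriorAlgebra.ι ℝ X *
      (e.proj (e.pointwiseDegree n Sig p) ξ : ExteriorAlgebra ℝ (LieG G)) = 0}
  add_mem' hX hY ξ hξ := by rw [map_add, add_mul, hX ξ hξ, hY ξ hξ, add_zero]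
  zero_mem' ξ _ := by rw [map_zero, zero_mul]
  smul_mem' c X hX ξ hξ := by rw [map_smul, smul_mul_assoc, hX ξ hξ, smul_zero]

/-- `p` is algebraically regular: `𝒜_pΣ` is a subalgebra of `Lie(G)`. -/
def GradedBasis.IsAlgebraicallyRegular {S : HomogeneousGroup G} {q : ℕ} (e : GradedBasis S q)
    (n : ℕ) (Sig : Set G) (p : G) : Prop :=
  ∀ X ∈ e.lieHTangent n Sig p, ∀ Y ∈ e.lieHTangent n Sig p, ⁅X, Y⁆ ∈ e.lieHTangent n Sig p

/-- The homogeneous tangent space `A_pΣ = exp 𝒜_pΣ`. -/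
def GradedBasis.hTangent {S : HomogeneousGroup G} {q : ℕ} (e : GradedBasis S q)
    (n : ℕ) (Sig : Set G) (p : G) : Set G :=
  {a | ∃ X ∈ e.lieHTangent n Sig p, IsExp X a}

/-- `p` is a horizontal point of `Σ`: it is algebraically regular and its homogeneous tangent
space is a horizontal subgroup. -/
def GradedBasis.IsHorizontalPoint {S : HomogeneousGroup G} {q : ℕ} (e : GradedBasis S q)
    (n : ℕ) (Sig : Set G) (p : G) : Prop :=
  p ∈ Sig ∧ e.IsAlgebraicallyRegular n Sig p ∧ S.IsHorizontalSubgroup (e.hTangent n Sig p)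

/-- `Σ` is an `n`-dimensional horizontal submanifold: all of its points are horizontal. -/
def GradedBasis.IsHorizontalSubmanifold {S : HomogeneousGroup G} {q : ℕ} (e : GradedBasis S q)
    (n : ℕ) (Sig : Set G) : Prop :=
  IsC1Submanifold n Sig ∧ ∀ p ∈ Sig, e.IsHorizontalPoint n Sig p

end

open scoped Manifold ContDiff

noncomputable section

variable {G : Type*} [NormedAddCommGroup G] [NormedSpace ℝ G] [FiniteDimensional ℝ G] [Group G]

/-! ### Low order terms of the Baker-Campbell-Hausdorff series -/

/-! Only layers 1 and 2 of the group law matter: `(xy)₁ = x₁ + y₁` and `(xy)₂ = x₂ + y₂ + ½[x₁, y₁]`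
(`layerProj_one_mul`, `layerProj_two_mul`). Differentiating them, a horizontal vector `v` at `p`
satisfies `v₂ = ½[p₁, v₁]`. For a chart `Ψ` of a submanifold with horizontal tangent spaces, `f =
Ψ₁` and `g = Ψ₂` thus satisfy `dg = ½[f, df]`. Formally, `d(dg) = 0` then says `[df(v), df(w)] = 0`.
As `Ψ` is only `C^1`, `df` cannot be differentiated. But `g - ½[f(x), f]` has derivative `½[f -
f(x), df]`, and this is differentiable at `x` because its first factor vanishes there and `df` is
continuous. Its derivative `½[df(v), df(w)]` is symmetric in `v`, `w` as a second derivative and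
antisymmetric as a Lie product, hence zero (`apply_fderiv_fderiv_eq_zero`). On the algebraic side,
the tangent multivector comes from a wedge of `n` horizontal left invariant fields. It is
homogeneous of degree `n`, so its top projection is itself and `𝒜_pΣ` lies in the span of these
fields. The elements of `𝒜_pΣ` therefore commute, the Baker-Campbell-Hausdorff product on it is
addition, and `exp` is the identity map. All the required properties follow. -/

lemma mem_dynkinWord {V : Type*} {x y a : V} {l : List (ℕ × ℕ)} (h : a ∈ dynkinWord x y l) :
    a = x ∨ a = y := by
  simp only [dynkinWord, List.mem_flatMap, List.mem_append] at h
  obtain ⟨_, _, h | h⟩ := h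
  · exact Or.inl (List.eq_of_mem_replicate h)
  · exact Or.inr (List.eq_of_mem_replicate h)

lemma length_dynkinWord_ofFn {V : Type*} (x y : V) {n : ℕ} (f : Fin n → ℕ × ℕ) :
    (dynkinWord x y (List.ofFn f)).length = ∑ i, ((f i).1 + (f i).2) := by
  simp [dynkinWord, List.length_flatMap, List.map_ofFn, List.sum_ofFn]

section BCH

variable {V : Type*} [AddCommGroup V] [Module ℝ V] (B : V →ₗ[ℝ] V →ₗ[ℝ] V)

lemma nestedBracket_eq_zero_of_commute :
    ∀ l : List V, 2 ≤ l.length → (∀ a ∈ l, ∀ b ∈ l, B a b = 0) → nestedBracket B l = 0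
  | [], h, _ => by simp at h
  | [_], h, _ => by simp at h
  | [a, b], _, hc => hc a (by simp) b (by simp)
  | a :: b :: c :: l, _, hc => by
    have ih := nestedBracket_eq_zero_of_commute (b :: c :: l) (by simp)
      fun x hx y hy => hc x (List.mem_cons_of_mem _ hx) y (List.mem_cons_of_mem _ hy)
    rw [nestedBracket, ih, map_zero]

lemma sum_of_mem_dynkinIndex {n j : ℕ} {f : Fin n → ℕ × ℕ} (hf : f ∈ dynkinIndex n j) :
    ∑ i, ((f i).1 + (f i).2) = j := by
  simp only [dynkinIndex, Finset.mem_filter] at hf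
  exact hf.2.2

lemma dynkinIndex_one (j : ℕ) (hj : 0 < j) :
    dynkinIndex 1 j = (Finset.range (j + 1)).image fun r => ![(r, j - r)] := by
  ext f
  simp only [dynkinIndex, Finset.mem_filter, Fintype.mem_piFinset, Finset.mem_product,
    Finset.mem_range, Finset.mem_image, Fin.forall_fin_one, Fin.sum_univ_one, Fin.isValue]
  constructor
  · rintro ⟨_, _, h⟩
    refine ⟨(f 0).1, by omega, ?_⟩
    ext i <;> fin_cases i <;> simp
    omega
  · rintro ⟨r, hr, rfl⟩
    simp
    omega

lemma dynkinIndex_two_two :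
    dynkinIndex 2 2 = {![(1, 0), (1, 0)], ![(1, 0), (0, 1)], ![(0, 1), (1, 0)],
      ![(0, 1), (0, 1)]} := by
  ext f
  obtain ⟨⟨a, b⟩, ha⟩ : ∃ p, f 0 = p := ⟨_, rfl⟩
  obtain ⟨⟨c, d⟩, hc⟩ : ∃ p, f 1 = p := ⟨_, rfl⟩
  simp only [dynkinIndex, Finset.mem_filter, Fintype.mem_piFinset, Finset.mem_product,
    Finset.mem_range, Finset.mem_insert, Finset.mem_singleton, Fin.forall_fin_two,
    Fin.sum_univ_two, funext_iff, ha, hc, Matrix.cons_val_zero, Matrix.cons_val_one, Prod.mk.injEq]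
  omega

lemma bchTerm_one (x y : V) : bchTerm B 1 x y = x + y := by
  have h : dynkinIndex 1 1 = {![(0, 1)], ![(1, 0)]} := by
    rw [dynkinIndex_one 1 one_pos]
    rfl
  have hne : (![(0, 1)] : Fin 1 → ℕ × ℕ) ≠ ![(1, 0)] := by decide
  simp [bchTerm, h, Finset.sum_pair hne, dynkinWord, nestedBracket, add_comm]

lemma bchTerm_two (hB : ∀ x, B x x = 0) (x y : V) : bchTerm B 2 x y = (2⁻¹ : ℝ) • B x y := by
  have h : dynkinIndex 1 2 = {![(0, 2)], ![(1, 1)], ![(2, 0)]} := by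
    rw [dynkinIndex_one 2 two_pos]
    rfl
  have hyx : B y x = -B x y := by
    have := hB (x + y)
    simp only [map_add, LinearMap.add_apply, hB, zero_add, add_zero] at this
    exact eq_neg_of_add_eq_zero_left (by rw [add_comm] at this; rw [add_comm]; exact this)
  have hI : Finset.Icc 1 2 = {1, 2} := rfl
  rw [bchTerm, hI, Finset.sum_pair (by norm_num), h, dynkinIndex_two_two,
    Finset.sum_insert (by decide), Finset.sum_insert (by decide), Finset.sum_singleton,
    Finset.sum_insert (by decide), Finset.sum_insert (by decide), Finset.sum_insert (by decide),
    Finset.sum_singleton]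
  -- For `n = 2` the four words sum to `B x y + B y x = 0`; what remains is the word `x y` of `n =
  -- 1`, with coefficient `1/2`.
  simp [dynkinWord, nestedBracket, hB, hyx]

lemma bchTerm_eq_zero_of_nestedBracket {j : ℕ} {x y : V}
    (h : ∀ l : List V, l.length = j → (∀ a ∈ l, a = x ∨ a = y) → nestedBracket B l = 0) :
    bchTerm B j x y = 0 := by
  rw [bchTerm]
  refine Finset.sum_eq_zero fun n _ => ?_
  rw [Finset.sum_eq_zero fun f hf => ?_, smul_zero]
  rw [h _ ((length_dynkinWord_ofFn x y f).trans (sum_of_mem_dynkinIndex hf))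
    fun a ha => mem_dynkinWord ha, smul_zero]

lemma bch_of_commute (hB : ∀ x, B x x = 0) {N : ℕ} (hN : 1 ≤ N) {x y : V} (hxy : B x y = 0)
    (hyx : B y x = 0) : bch B N x y = x + y := by
  rw [bch, Finset.sum_eq_single_of_mem 1 (by simpa using hN), bchTerm_one]
  intro j hj hj1
  have hj2 : 2 ≤ j := by have := (Finset.mem_Icc.1 hj).1; omega
  refine bchTerm_eq_zero_of_nestedBracket B fun l hl hlm =>
    nestedBracket_eq_zero_of_commute B l (hl ▸ hj2) fun a ha b hb => ?_
  rcases hlm a ha with rfl | rfl <;> rcases hlm b hb with rfl | rfl <;>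
    first | exact hB _ | assumption

end BCH

/-! ### The grading of a homogeneous group -/

namespace HomogeneousGroup

variable (S : HomogeneousGroup G)

/-- The linear projection of `G` onto the layer `H^k`. -/
def layerProj (k : ℕ) : G →ₗ[ℝ] G :=
  (S.layer k).subtype ∘ₗ DirectSum.component ℝ ℕ (fun i => S.layer i) k ∘ₗ
    (LinearEquiv.ofBijective (DirectSum.coeLinearMap S.layer) S.isInternal).symm.toLinearMap

lemma decompose_of_mem {i : ℕ} {x : G} (hx : x ∈ S.layer i) :
    (LinearEquiv.ofBijective (DirectSum.coeLinearMap S.layer) S.isInternal).symm x =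
      DirectSum.lof ℝ ℕ (fun i => S.layer i) i ⟨x, hx⟩ := by
  rw [LinearEquiv.symm_apply_eq]
  exact (DirectSum.coeLinearMap_lof S.layer i ⟨x, hx⟩).symm

lemma layerProj_mem (k : ℕ) (x : G) : S.layerProj k x ∈ S.layer k := by
  simp [layerProj]

lemma layerProj_of_mem {k : ℕ} {x : G} (hx : x ∈ S.layer k) : S.layerProj k x = x := by
  simp [layerProj, S.decompose_of_mem hx, DirectSum.component.lof_self]

lemma layerProj_of_mem_ne {i k : ℕ} (hik : i ≠ k) {x : G} (hx : x ∈ S.layer i) :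
    S.layerProj k x = 0 := by
  simp [layerProj, S.decompose_of_mem hx, DirectSum.component.of, hik]

lemma eq_zero_of_layerProj {x : G} (h : ∀ k, S.layerProj k x = 0) : x = 0 := by
  rw [← (LinearEquiv.ofBijective (DirectSum.coeLinearMap S.layer) S.isInternal).symm.map_eq_zero_iff]
  ext k
  have hk := h k
  simp only [layerProj, LinearMap.comp_apply, Submodule.subtype_apply,
    Submodule.coe_eq_zero] at hk
  exact congrArg Subtype.val hk

lemma layer_induction {p : G → Prop} (mem : ∀ i, ∀ x ∈ S.layer i, p x)
    (add : ∀ x y, p x → p y → p (x + y)) (x : G) : p x := by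
  have hx : x ∈ ⨆ i, S.layer i := by
    rw [S.isInternal.submodule_iSup_eq_top]
    trivial
  exact Submodule.iSup_induction (motive := p) _ hx mem (mem 0 0 (zero_mem _)) add

/-- Both sides are bilinear, so `x` and `y` may be taken homogeneous; then at most one pair
contributes. -/
lemma layerProj_lie (k : ℕ) (x y : G) :
    S.layerProj k (S.lie x y) =
      ∑ p ∈ Finset.HasAntidiagonal.antidiagonal k, S.lie (S.layerProj p.1 x) (S.layerProj p.2 y) := by
  induction x using S.layer_induction with
  | add x x' hx hx' => simp [hx, hx', Finset.sum_add_distrib]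
  | mem i x hx =>
    induction y using S.layer_induction with
    | add y y' hy hy' => simp [hy, hy', Finset.sum_add_distrib]
    | mem j y hy =>
      have hxy := S.lie_mem i j x hx y hy
      have hne : ∀ p : ℕ × ℕ, p ≠ (i, j) →
          S.lie (S.layerProj p.1 x) (S.layerProj p.2 y) = 0 := by
        intro p hp
        by_cases h : i = p.1
        · have : j ≠ p.2 := fun h' => hp (Prod.ext h.symm h'.symm)
          rw [S.layerProj_of_mem_ne this hy, map_zero]
        · rw [S.layerProj_of_mem_ne h hx, map_zero, LinearMap.zero_apply]
      by_cases hk : i + j = k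
      · rw [Finset.sum_eq_single_of_mem (i, j) (by simpa using hk) fun p _ hp => hne p hp,
          S.layerProj_of_mem hx, S.layerProj_of_mem hy, S.layerProj_of_mem (hk ▸ hxy)]
      · rw [S.layerProj_of_mem_ne hk hxy, Finset.sum_eq_zero]
        intro p hp
        refine hne p ?_
        rintro rfl
        exact hk (by simpa using hp)

lemma layerProj_zero_apply (x : G) : S.layerProj 0 x = 0 := by
  simpa [S.layer_zero] using S.layerProj_mem 0 x

lemma layerProj_one_lie (x y : G) : S.layerProj 1 (S.lie x y) = 0 := by
  rw [S.layerProj_lie, Finset.sum_eq_zero]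
  intro p hp
  have : p.1 = 0 ∨ p.2 = 0 := by have := Finset.HasAntidiagonal.mem_antidiagonal.1 hp; omega
  rcases this with h | h <;> simp [h, S.layerProj_zero_apply]

lemma layerProj_two_lie (x y : G) :
    S.layerProj 2 (S.lie x y) = S.lie (S.layerProj 1 x) (S.layerProj 1 y) := by
  rw [S.layerProj_lie, Finset.sum_eq_single_of_mem (1, 1) (by simp)]
  intro p hp hne
  have : p.1 = 0 ∨ p.2 = 0 := by
    have h := Finset.HasAntidiagonal.mem_antidiagonal.1 hp
    by_contra! h0
    exact hne (Prod.ext (by omega) (by omega))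
  rcases this with h | h <;> simp [h, S.layerProj_zero_apply]

/-- As layer 0 is trivial, each letter has degree at least 1, so a product of `m` letters has no
component below degree `m`. -/
lemma layerProj_nestedBracket :
    ∀ (l : List G) (k : ℕ), k < l.length → S.layerProj k (nestedBracket S.lie l) = 0
  | [], k, hk => by simp at hk
  | [a], k, hk => by
    obtain rfl : k = 0 := by simpa using hk
    exact S.layerProj_zero_apply _
  | a :: b :: l, k, hk => by
    rw [nestedBracket, S.layerProj_lie, Finset.sum_eq_zero]
    intro p hp
    have hp := Finset.HasAntidiagonal.mem_antidiagonal.1 hp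
    by_cases h0 : p.1 = 0
    · rw [h0, S.layerProj_zero_apply, map_zero, LinearMap.zero_apply]
    · rw [layerProj_nestedBracket (b :: l) p.2 (by simp at hk ⊢; omega), map_zero]

lemma layerProj_bchTerm {j k : ℕ} (hkj : k < j) (x y : G) :
    S.layerProj k (bchTerm S.lie j x y) = 0 := by
  rw [bchTerm, map_sum]
  refine Finset.sum_eq_zero fun n _ => ?_
  rw [map_smul, map_sum, Finset.sum_eq_zero fun f hf => ?_, smul_zero]
  rw [map_smul, S.layerProj_nestedBracket, smul_zero]
  rwa [length_dynkinWord_ofFn x y f, sum_of_mem_dynkinIndex hf]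

lemma bchTerm_eq_zero {j : ℕ} (hj : S.step < j) (x y : G) : bchTerm S.lie j x y = 0 := by
  refine S.eq_zero_of_layerProj fun k => ?_
  rcases lt_or_ge k j with h | h
  · exact S.layerProj_bchTerm h x y
  · simpa [S.layer_of_step_lt k (by omega)] using S.layerProj_mem k (bchTerm S.lie j x y)

lemma one_le_step : 1 ≤ S.step := by
  by_contra h
  have h0 : S.step = 0 := by omega
  exact S.layer_step_ne_bot (h0 ▸ S.layer_zero)

lemma layerProj_mul_le_two {k : ℕ} (hk : k ≤ 2) (x y : G) :
    S.layerProj k (x * y) =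
      S.layerProj k (x + y) + S.layerProj k ((2⁻¹ : ℝ) • S.lie x y) := by
  -- Extending the sum past the step adds only zeros and ensures that `j = 2` occurs even in step 1.
  have h : x * y = ∑ j ∈ Finset.Icc 1 (S.step + 2), bchTerm S.lie j x y := by
    rw [S.mul_eq_bch, bch]
    refine Finset.sum_subset (Finset.Icc_subset_Icc_right (by omega)) fun j hj hj' => ?_
    refine S.bchTerm_eq_zero ?_ x y
    simp only [Finset.mem_Icc] at hj hj'
    omega
  rw [h, map_sum, ← Finset.sum_subset (s₁ := {1, 2}), Finset.sum_pair (by norm_num), bchTerm_one,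
    bchTerm_two _ S.lie_self]
  · intro j hj
    simp only [Finset.mem_insert, Finset.mem_singleton, Finset.mem_Icc] at hj ⊢
    omega
  · intro j hj hj'
    refine S.layerProj_bchTerm ?_ x y
    simp only [Finset.mem_insert, Finset.mem_singleton, Finset.mem_Icc] at hj hj'
    omega

lemma layerProj_one_mul (x y : G) :
    S.layerProj 1 (x * y) = S.layerProj 1 x + S.layerProj 1 y := by
  rw [S.layerProj_mul_le_two (by norm_num), map_smul, S.layerProj_one_lie, smul_zero, add_zero,
    map_add]

lemma layerProj_two_mul (x y : G) :
    S.layerProj 2 (x * y) = S.layerProj 2 x + S.layerProj 2 y +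
      (2⁻¹ : ℝ) • S.lie (S.layerProj 1 x) (S.layerProj 1 y) := by
  rw [S.layerProj_mul_le_two le_rfl, map_smul, S.layerProj_two_lie, map_add]

lemma lie_swap (x y : G) : S.lie y x = -S.lie x y := by
  have := S.lie_self (x + y)
  simp only [map_add, LinearMap.add_apply, S.lie_self, zero_add, add_zero] at this
  exact eq_neg_of_add_eq_zero_left this

lemma mul_of_commute {x y : G} (h : S.lie x y = 0) : x * y = x + y := by
  rw [S.mul_eq_bch, bch_of_commute _ S.lie_self S.one_le_step h (by rw [S.lie_swap, h, neg_zero])]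

lemma one_eq_zero (S : HomogeneousGroup G) : (1 : G) = 0 := by
  have h : (0 : G) * 0 = 0 := by rw [S.mul_of_commute (by simp), add_zero]
  exact (mul_eq_left.1 h).symm

lemma dilation_of_mem_layer_one (r : ℝ) {x : G} (hx : x ∈ S.layer 1) :
    S.dilation r x = r • x := by
  simp [dilation, S.decompose_of_mem hx]

lemma pow_eq_smul (S : HomogeneousGroup G) (x : G) (m : ℕ) : x ^ m = (m : ℝ) • x := by
  induction m with
  | zero => simp [S.one_eq_zero]
  | succ m ih =>
    rw [pow_succ, ih, S.mul_of_commute (by simp [S.lie_self])]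
    push_cast
    rw [add_smul, one_smul]

end HomogeneousGroup

/-! ### Smoothness of the group operation and left invariant vector fields -/

/-- Turns a word in the values of `f` and `g` into a list of functions evaluated at `z`, so that
smoothness follows by induction on the list. -/
lemma map_dynkinWord {α V : Type*} (f g : α → V) (z : α) (l : List (ℕ × ℕ)) :
    (dynkinWord f g l).map (fun k => k z) = dynkinWord (f z) (g z) l := by
  simp [dynkinWord, List.map_flatMap]

section Smooth

variable {E V : Type*} [NormedAddCommGroup E] [NormedSpace ℝ E] [NormedAddCommGroup V]
  [NormedSpace ℝ V] [FiniteDimensional ℝ V] (B : V →ₗ[ℝ] V →ₗ[ℝ] V)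

/-- A bilinear map on a finite dimensional space, as a continuous bilinear map. -/
def LinearMap.toContinuousBilinearMapOfFiniteDimensional : V →L[ℝ] V →L[ℝ] V :=
  LinearMap.toContinuousLinearMap (LinearMap.toContinuousLinearMap.toLinearMap ∘ₗ B)

lemma ContDiff.nestedBracket :
    ∀ l : List (E → V), (∀ f ∈ l, ContDiff ℝ ∞ f) →
      ContDiff ℝ ∞ fun z => nestedBracket B (l.map fun f => f z)
  | [], _ => contDiff_const
  | [f], h => h f (by simp)
  | f :: g :: l, h => by
    have ih := ContDiff.nestedBracket (g :: l) fun k hk => h k (List.mem_cons_of_mem _ hk)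
    exact (B.toContinuousBilinearMapOfFiniteDimensional.contDiff.comp
      (h f (by simp))).clm_apply ih

lemma ContDiff.bch (N : ℕ) {f g : E → V} (hf : ContDiff ℝ ∞ f) (hg : ContDiff ℝ ∞ g) :
    ContDiff ℝ ∞ fun z => bch B N (f z) (g z) := by
  unfold _root_.bch bchTerm
  refine ContDiff.sum fun j _ => ContDiff.sum fun n _ => contDiff_const.smul
    (ContDiff.sum fun k _ => contDiff_const.smul ?_)
  simp_rw [← map_dynkinWord]
  refine ContDiff.nestedBracket B _ fun h hh => ?_
  rcases mem_dynkinWord hh with rfl | rfl <;> assumption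

end Smooth

namespace HomogeneousGroup

variable (S : HomogeneousGroup G)

lemma contDiff_mul {E : Type*} [NormedAddCommGroup E] [NormedSpace ℝ E] {f g : E → G}
    (S : HomogeneousGroup G) (hf : ContDiff ℝ ∞ f) (hg : ContDiff ℝ ∞ g) :
    ContDiff ℝ ∞ fun z => f z * g z := by
  simp_rw [S.mul_eq_bch]
  exact hf.bch S.lie S.step hg

lemma differentiable_mul_left (S : HomogeneousGroup G) (p : G) :
    Differentiable ℝ fun y : G => p * y :=
  (S.contDiff_mul contDiff_const contDiff_id).differentiable (by simp)

lemma evalAt_eq_fderiv (S : HomogeneousGroup G) (p : G) (X : G) :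
    evalAt p X = fderiv ℝ (fun y : G => p * y) 0 X := by
  have h : evalAt p X = fderiv ℝ (fun y : G => p * y) 1 X := by
    rw [← mfderiv_eq_fderiv]
    rfl
  rw [h, S.one_eq_zero]

lemma hasDerivAt_mul_smul (S : HomogeneousGroup G) (p X : G) :
    HasDerivAt (fun t : ℝ => p * (t • X)) (evalAt p X) 0 := by
  have h1 : HasDerivAt (fun t : ℝ => t • X) X 0 := by
    simpa using (hasDerivAt_id (0 : ℝ)).smul_const X
  rw [S.evalAt_eq_fderiv]
  have h2 : HasFDerivAt (fun y : G => p * y) (fderiv ℝ (fun y : G => p * y) 0)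
      ((0 : ℝ) • X) := by
    rw [zero_smul]
    exact (S.differentiable_mul_left p 0).hasFDerivAt
  exact h2.comp_hasDerivAt (0 : ℝ) h1

lemma hasDerivAt_linearMap_mul_smul (S : HomogeneousGroup G) (L : G →ₗ[ℝ] G) (p X : G) :
    HasDerivAt (fun t : ℝ => L (p * (t • X))) (L (evalAt p X)) 0 :=
  (LinearMap.toContinuousLinearMap L).hasFDerivAt.comp_hasDerivAt (0 : ℝ)
    (S.hasDerivAt_mul_smul p X)

lemma layerProj_one_evalAt (p X : G) :
    S.layerProj 1 (evalAt p X) = S.layerProj 1 X := by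
  refine (S.hasDerivAt_linearMap_mul_smul (S.layerProj 1) p X).unique ?_
  simp_rw [S.layerProj_one_mul, map_smul]
  simpa using ((hasDerivAt_id (0 : ℝ)).smul_const (S.layerProj 1 X)).const_add (S.layerProj 1 p)

/-- The second layer of `p * (t • X)` is affine in `t`. For `X` in `H^1` the formula says `v₂ =
½[p₁, v₁]` with `v = X(p)`. -/
lemma layerProj_two_evalAt (p X : G) :
    S.layerProj 2 (evalAt p X) =
      S.layerProj 2 X + (2⁻¹ : ℝ) • S.lie (S.layerProj 1 p) (S.layerProj 1 X) := by
  refine (S.hasDerivAt_linearMap_mul_smul (S.layerProj 2) p X).unique ?_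
  have h : ∀ t : ℝ, S.layerProj 2 (p * (t • X)) = S.layerProj 2 p + t • (S.layerProj 2 X +
      (2⁻¹ : ℝ) • S.lie (S.layerProj 1 p) (S.layerProj 1 X)) := by
    intro t
    rw [S.layerProj_two_mul]
    simp only [map_smul, smul_add, smul_comm t (2⁻¹ : ℝ), add_assoc]
  simp_rw [h]
  simpa using ((hasDerivAt_id (0 : ℝ)).smul_const (S.layerProj 2 X +
      (2⁻¹ : ℝ) • S.lie (S.layerProj 1 p) (S.layerProj 1 X))).const_add (S.layerProj 2 p)

lemma evalAt_injective (S : HomogeneousGroup G) (p : G) :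
    Function.Injective (evalAt p : LieG G →ₗ[ℝ] G) := by
  have hcomp : ((fun y : G => p⁻¹ * y) ∘ fun y : G => p * y) = id := by
    ext y
    simp
  have h := fderiv_comp (0 : G) (S.differentiable_mul_left p⁻¹ (p * 0))
    (S.differentiable_mul_left p 0)
  rw [hcomp, fderiv_id] at h
  refine Function.LeftInverse.injective
    (g := (fderiv ℝ (fun y : G => p⁻¹ * y) (p * 0) : G → G)) fun X => ?_
  rw [S.evalAt_eq_fderiv]
  exact (DFunLike.congr_fun h X).symm

/-! ### Brackets of left invariant fields with commuting values at the unit -/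

lemma differentiable_evalAt (S : HomogeneousGroup G) (X : G) :
    Differentiable ℝ fun p : G => (evalAt p X : G) := by
  have h : ContDiff ℝ ∞ fun p : G => fderiv ℝ (fun y : G => p * y) 0 :=
    ContDiff.fderiv (n := ∞) (f := fun p y : G => p * y) (g := fun _ => (0 : G))
      (S.contDiff_mul contDiff_fst contDiff_snd) contDiff_const (by norm_cast)
  simp_rw [S.evalAt_eq_fderiv]
  exact (h.clm_apply contDiff_const).differentiable (by simp)

lemma evalAt_zero (S : HomogeneousGroup G) (X : G) : evalAt (0 : G) X = X := by
  rw [S.evalAt_eq_fderiv]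
  have h : (fun y : G => 0 * y) = id := by
    ext y
    rw [← S.one_eq_zero, one_mul, id]
  rw [h, fderiv_id]
  rfl

/-- Multiplication of `t • X` by multiples of `Y` is addition, so the field of `Y` is constant along
the line `ℝX`. Hence its derivative at the unit in direction `X` vanishes, which kills each half of
the bracket. -/
lemma evalAt_smul_of_commute {X Y : G} (h : S.lie X Y = 0) (t : ℝ) :
    evalAt (t • X) Y = (Y : G) := by
  refine (S.hasDerivAt_mul_smul (t • X) Y).unique ?_
  have hm : ∀ s : ℝ, (t • X) * (s • Y) = t • X + s • Y := fun s =>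
    S.mul_of_commute (by simp [h])
  simp_rw [hm]
  simpa using ((hasDerivAt_id (0 : ℝ)).smul_const Y).const_add (t • X)

lemma fderiv_evalAt_of_commute {X Y : G} (h : S.lie X Y = 0) :
    fderiv ℝ (fun p : G => (evalAt p Y : G)) 0 X = 0 := by
  have h1 : HasDerivAt (fun t : ℝ => t • X) X 0 := by
    simpa using (hasDerivAt_id (0 : ℝ)).smul_const X
  have h2 : HasFDerivAt (fun p : G => (evalAt p Y : G))
      (fderiv ℝ (fun p : G => (evalAt p Y : G)) 0) ((0 : ℝ) • X) := by
    rw [zero_smul]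
    exact (S.differentiable_evalAt Y 0).hasFDerivAt
  refine (h2.comp_hasDerivAt (0 : ℝ) h1).unique ?_
  have hc : ((fun p : G => (evalAt p Y : G)) ∘ fun t : ℝ => t • X) = fun _ => Y :=
    funext fun t => S.evalAt_smul_of_commute h t
  rw [hc]
  exact hasDerivAt_const _ _

lemma bracket_eq_lieBracket (S : HomogeneousGroup G) (X Y : LieG G) :
    ⁅X, Y⁆ = VectorField.lieBracket ℝ
      (fun p : G => (evalAt p X : G)) (fun p : G => (evalAt p Y : G)) 0 := by
  have key : ∀ V W : G → G,
      VectorField.mlieBracket 𝓘(ℝ, G) V W = VectorField.lieBracket ℝ V W := fun V W => by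
    have h : VectorField.mlieBracketWithin 𝓘(ℝ, G) V W Set.univ =
        VectorField.lieBracketWithin ℝ V W Set.univ :=
      VectorField.mlieBracketWithin_eq_lieBracketWithin
    rw [VectorField.lieBracketWithin_univ] at h
    exact VectorField.mlieBracketWithin_univ.symm.trans h
  rw [← S.one_eq_zero]
  exact congrFun (key _ _) 1

lemma lieBracket_evalAt_of_commute {X Y : G} (h : S.lie X Y = 0) :
    VectorField.lieBracket ℝ (fun p : G => (evalAt p X : G)) (fun p : G => (evalAt p Y : G)) 0 =
      0 := by
  have h' : S.lie Y X = 0 := by rw [S.lie_swap, h, neg_zero]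
  have hX := S.fderiv_evalAt_of_commute h'
  have hY := S.fderiv_evalAt_of_commute h
  rw [← S.evalAt_zero Y] at hX
  rw [← S.evalAt_zero X] at hY
  exact (congrArg₂ (· - ·) hY hX).trans (sub_zero 0)

lemma bracket_eq_zero_of_commute {X Y : LieG G} (h : S.lie (X : G) (Y : G) = 0) :
    ⁅X, Y⁆ = 0 :=
  (S.bracket_eq_lieBracket X Y).trans (S.lieBracket_evalAt_of_commute h)

/-! ### The exponential map -/

lemma isExp_iff (S : HomogeneousGroup G) (X a : G) : IsExp X a ↔ a = X := by
  constructor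
  · rintro ⟨γ, hγ, hd, rfl⟩
    have h0 : γ 0 = 1 := by
      have := hγ 0 0
      rw [add_zero] at this
      exact (mul_eq_left.1 this.symm)
    have hpow : ∀ (s : ℝ) (m : ℕ), γ (m * s) = γ s ^ m := by
      intro s m
      induction m with
      | zero => simp [h0]
      | succ m ih => rw [pow_succ, ← ih, ← hγ]; push_cast; ring_nf
    -- Powers are multiples, so `γ 1 = γ (1/m) ^ m = m • γ (1/m)`: the difference quotient at `1/m`
    -- is constantly `γ 1`, while it tends to `X`.
    have h1 : ∀ m : ℕ, m ≠ 0 → ((m : ℝ)⁻¹)⁻¹ • (γ (0 + (m : ℝ)⁻¹) - γ 0) = γ 1 := by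
      intro m hm
      have hm' : (m : ℝ) ≠ 0 := Nat.cast_ne_zero.2 hm
      rw [h0, S.one_eq_zero, sub_zero, zero_add, inv_inv, ← S.pow_eq_smul, ← hpow,
        mul_inv_cancel₀ hm']
    have ht : Filter.Tendsto (fun m : ℕ => ((m : ℝ))⁻¹) Filter.atTop (nhdsWithin 0 {0}ᶜ) := by
      refine tendsto_nhdsWithin_iff.2 ⟨tendsto_inv_atTop_nhds_zero_nat, ?_⟩
      filter_upwards [Filter.eventually_ne_atTop 0] with m hm
      simpa using hm
    have h2 := (hasDerivAt_iff_tendsto_slope_zero.1 hd).comp ht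
    refine tendsto_nhds_unique (tendsto_const_nhds.congr' ?_) h2
    filter_upwards [Filter.eventually_ne_atTop 0] with m hm
    exact (h1 m hm).symm
  · rintro rfl
    refine ⟨fun t => t • a, fun s t => ?_, ?_, one_smul ℝ a⟩
    · have : S.lie (s • a) (t • a) = 0 := by
        simp [S.lie_self]
      exact (add_smul s t a).trans (S.mul_of_commute this).symm
    · simpa using (hasDerivAt_id (0 : ℝ)).smul_const a

end HomogeneousGroup

/-! ### Symmetry of a second derivative for `C^1` maps -/

section Symmetry

open Asymptotics Filter Topology

variable {E F K L : Type*} [NormedAddCommGroup E] [NormedSpace ℝ E] [NormedAddCommGroup F]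
  [NormedSpace ℝ F] [NormedAddCommGroup K] [NormedSpace ℝ K] [NormedAddCommGroup L]
  [NormedSpace ℝ L]

/-- The product of a differentiable map that vanishes at `x` and of a map that is continuous at `x`
is differentiable at `x`. -/
lemma HasFDerivAt.clm_comp_of_eq_zero {a : E → K →L[ℝ] L} {a' : E →L[ℝ] K →L[ℝ] L}
    {b : E → F →L[ℝ] K} {x : E} (ha : HasFDerivAt a a' x) (hax : a x = 0)
    (hb : ContinuousAt b x) :
    HasFDerivAt (fun u => (a u).comp (b u))
      (((ContinuousLinearMap.compL ℝ F K L).flip (b x)).comp a') x := by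
  have h1 : HasFDerivAt (fun u => (a u).comp (b x))
      (((ContinuousLinearMap.compL ℝ F K L).flip (b x)).comp a') x :=
    ((ContinuousLinearMap.compL ℝ F K L).flip (b x)).hasFDerivAt.comp x ha
  -- Here `a u = O(u - x)` and `b u - b x = o(1)`, so the product is `o(u - x)`.
  have h2 : HasFDerivAt (fun u => (a u).comp (b u - b x)) (0 : E →L[ℝ] F →L[ℝ] L) x := by
    refine HasFDerivAt.of_isLittleO ?_
    simp only [hax, ContinuousLinearMap.zero_comp, sub_zero, zero_apply]
    have hO : a =O[𝓝 x] fun u => u - x := by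
      simpa [hax] using ha.isBigO_sub
    have ho : (fun u => b u - b x) =o[𝓝 x] fun _ => (1 : ℝ) :=
      (isLittleO_one_iff ℝ).2 (by simpa using hb.tendsto.sub_const (b x))
    refine (IsBigO.of_bound 1 (Eventually.of_forall fun u => ?_)).trans_isLittleO
      ((hO.norm_norm.mul_isLittleO ho.norm_left).trans_isBigO ?_)
    · rw [one_mul, norm_mul, norm_norm, norm_norm]
      exact ContinuousLinearMap.opNorm_comp_le _ _
    · simpa using (isBigO_refl (fun u => u - x) (𝓝 x)).norm_left
  refine ((h1.add h2).congr_fderiv (add_zero _)).congr_of_eventuallyEq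
    (Eventually.of_forall fun u => ?_)
  simp

/-- If `f`, `g` are of class `C^1` and `dg = c [f, df]` for an alternating bilinear map
`[·, ·]`, then `[df(v), df(w)] = 0`. -/
lemma apply_fderiv_fderiv_eq_zero {V : Type*} [NormedAddCommGroup V] [NormedSpace ℝ V]
    (B : V →L[ℝ] V →L[ℝ] V) (hB : ∀ x, B x x = 0) {c : ℝ} (hc : c ≠ 0)
    {f g : E → V} {f' g' : E → E →L[ℝ] V} {x : E}
    (hf : ∀ᶠ u in 𝓝 x, HasFDerivAt f (f' u) u) (hf' : ContinuousAt f' x)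
    (hg : ∀ᶠ u in 𝓝 x, HasFDerivAt g (g' u) u)
    (hfg : ∀ᶠ u in 𝓝 x, ∀ v, g' u v = c • B (f u) (f' u v)) (v w : E) :
    B (f' x v) (f' x w) = 0 := by
  -- The correction `c • B (f x) (f u)`, with `f x` frozen, makes the first factor of the derivative
  -- vanish at `x`; continuity of `f'` then suffices.
  have hh : ∀ᶠ u in 𝓝 x, HasFDerivAt (fun u => g u - c • B (f x) (f u))
      (c • (B (f u - f x)).comp (f' u)) u := by
    filter_upwards [hf, hg, hfg] with u hfu hgu hfgu
    refine (hgu.sub (((B (f x)).hasFDerivAt.comp u hfu).const_smul c)).congr_fderiv ?_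
    ext v
    simp [hfgu, smul_sub]
  have ha : HasFDerivAt (fun u => B (f u - f x)) (B.comp (f' x)) x :=
    B.hasFDerivAt.comp x (hf.self_of_nhds.sub_const (f x))
  have h2 := (ha.clm_comp_of_eq_zero (by simp) hf').const_smul c
  have hs := second_derivative_symmetric_of_eventually_of_real hh h2 v w
  have hs' : B (f' x v) (f' x w) = B (f' x w) (f' x v) := by
    simpa [hc] using hs
  have h0 := hB (f' x v + f' x w)
  simp only [map_add, add_apply, hB, zero_add, add_zero, ← hs'] at h0
  rw [← two_smul ℝ] at h0
  simpa using h0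

end Symmetry

/-! ### Tangent spaces of embedded `C^1` submanifolds -/

section Tangent

open Filter Topology

variable {F : Type*} [NormedAddCommGroup F] [NormedSpace ℝ F]
  {n : ℕ} {Sig : Set F} {Ω : Set (EuclideanSpace ℝ (Fin n))} {Ψ : EuclideanSpace ℝ (Fin n) → F}
  {x : EuclideanSpace ℝ (Fin n)}

lemma IsC1Chart.contDiffAt (h : IsC1Chart n Sig Ω Ψ) (hx : x ∈ Ω) : ContDiffAt ℝ 1 Ψ x :=
  h.2.1.contDiffAt (h.1.mem_nhds hx)

lemma IsC1Chart.hasFDerivAt (h : IsC1Chart n Sig Ω Ψ) (hx : x ∈ Ω) :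
    HasFDerivAt Ψ (fderiv ℝ Ψ x) x :=
  ((h.contDiffAt hx).differentiableAt one_ne_zero).hasFDerivAt

lemma IsC1Chart.range_fderiv_le (h : IsC1Chart n Sig Ω Ψ) (hx : x ∈ Ω) :
    (fderiv ℝ Ψ x).toLinearMap.range ≤ tangentSpaceAt Sig (Ψ x) := by
  rintro _ ⟨v, rfl⟩
  refine Submodule.subset_span ⟨fun t => Ψ (x + t • v), by simp, ?_, ?_⟩
  · have hc : Tendsto (fun t : ℝ => x + t • v) (𝓝 0) (𝓝 x) := by
      have : Continuous fun t : ℝ => x + t • v := by fun_prop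
      simpa using this.tendsto 0
    obtain ⟨U, -, hU⟩ := h.2.2.2.2
    filter_upwards [hc.eventually (h.1.mem_nhds hx)] with t ht
    exact (hU.subset (Set.mem_image_of_mem Ψ ht)).1
  · have h1 : HasDerivAt (fun t : ℝ => x + t • v) v 0 := by
      simpa using ((hasDerivAt_id (0 : ℝ)).smul_const v).const_add x
    have h2 : HasFDerivAt Ψ (fderiv ℝ Ψ x) (x + (0 : ℝ) • v) := by
      simpa using h.hasFDerivAt hx
    exact h2.comp_hasDerivAt (0 : ℝ) h1

/-- The embedding property makes the lifted parameters converge to `x`, which brings them into the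
domain of a local inverse. -/
lemma IsC1Chart.exists_lift (h : IsC1Chart n Sig Ω Ψ) (hx : x ∈ Ω) {γ : ℝ → F}
    (h0 : γ 0 = Ψ x) (hγ : ∀ᶠ t in 𝓝 0, γ t ∈ Sig) (hc : ContinuousAt γ 0) :
    ∃ c : ℝ → EuclideanSpace ℝ (Fin n), Tendsto c (𝓝 0) (𝓝 x) ∧
      ∀ᶠ t in 𝓝 0, Ψ (c t) = γ t := by
  classical
  obtain ⟨-, -, -, he, U, hUo, hU⟩ := h
  have hxU : γ 0 ∈ U := h0 ▸ (hU.subset (Set.mem_image_of_mem Ψ hx)).2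
  have hev : ∀ᶠ t in 𝓝 (0 : ℝ), ∃ u : Ω, Ψ u = γ t := by
    filter_upwards [hγ, hc.eventually (hUo.mem_nhds hxU)] with t ht htU
    obtain ⟨u, hu, hut⟩ := hU.symm.subset ⟨ht, htU⟩
    exact ⟨⟨u, hu⟩, hut⟩
  -- The default value is irrelevant: the condition holds for all `t` near 0.
  let c : ℝ → Ω := fun t => if ht : ∃ u : Ω, Ψ u = γ t then ht.choose else ⟨x, hx⟩
  have hcγ : ∀ᶠ t in 𝓝 0, Ψ (c t) = γ t := by
    filter_upwards [hev] with t ht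
    simp only [c, dif_pos ht]
    exact ht.choose_spec
  refine ⟨fun t => c t, ?_, hcγ⟩
  have hlim : Tendsto c (𝓝 0) (𝓝 ⟨x, hx⟩) := by
    rw [he.tendsto_nhds_iff]
    have : Tendsto γ (𝓝 0) (𝓝 (Ψ x)) := h0 ▸ hc
    exact this.congr' (hcγ.mono fun t ht => ht.symm)
  exact (continuous_subtype_val.tendsto _).comp hlim

lemma IsC1Chart.tangentSpaceAt_eq [FiniteDimensional ℝ F] (h : IsC1Chart n Sig Ω Ψ) (hx : x ∈ Ω) :
    tangentSpaceAt Sig (Ψ x) = (fderiv ℝ Ψ x).toLinearMap.range := by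
  refine le_antisymm (Submodule.span_le.2 ?_) (h.range_fderiv_le hx)
  rintro v ⟨γ, h0, hγ, hd⟩
  obtain ⟨c, hc, hcγ⟩ := h.exists_lift hx h0 hγ hd.continuousAt
  obtain ⟨L, hL⟩ := (fderiv ℝ Ψ x).toLinearMap.exists_leftInverse_of_injective
    (LinearMap.ker_eq_bot.2 (h.2.2.1 x hx))
  let L' : F →L[ℝ] EuclideanSpace ℝ (Fin n) := LinearMap.toContinuousLinearMap L
  -- With `L'` a left inverse of `dΨ(x)`, the map `L' ∘ Ψ` has derivative the identity at `x`, hence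
  -- a differentiable local inverse `φ`. Near 0, `γ = Ψ ∘ φ ∘ L' ∘ γ`, so its velocity lies in the
  -- range of `dΨ(x)`.
  have hs : HasStrictFDerivAt (fun u => L' (Ψ u))
      ((ContinuousLinearEquiv.refl ℝ (EuclideanSpace ℝ (Fin n)) :
        EuclideanSpace ℝ (Fin n) ≃L[ℝ] EuclideanSpace ℝ (Fin n)) :
        EuclideanSpace ℝ (Fin n) →L[ℝ] EuclideanSpace ℝ (Fin n)) x := by
    refine (L'.hasStrictFDerivAt.comp x
      ((h.contDiffAt hx).hasStrictFDerivAt one_ne_zero)).congr_fderiv ?_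
    ext1 u
    exact LinearMap.congr_fun hL u
  set φ := hs.localInverse
  have hφ : HasFDerivAt φ _ (L' (γ 0)) := h0 ▸ hs.to_localInverse.hasFDerivAt
  have hφx : φ (L' (γ 0)) = x := by
    rw [h0]
    exact hs.localInverse_apply_image
  have hd1 : HasDerivAt (fun t => φ (L' (γ t))) (L' v) 0 :=
    HasFDerivAt.comp_hasDerivAt (f := fun t => L' (γ t)) (0 : ℝ) hφ (L'.hasFDerivAt.comp_hasDerivAt (0 : ℝ) hd)
  have hd2 : HasDerivAt (fun t => Ψ (φ (L' (γ t)))) (fderiv ℝ Ψ x (L' v)) 0 :=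
    HasFDerivAt.comp_hasDerivAt (0 : ℝ) (hφx.symm ▸ h.hasFDerivAt hx) hd1
  have heq : γ =ᶠ[𝓝 0] fun t => Ψ (φ (L' (γ t))) := by
    filter_upwards [hcγ, hc.eventually hs.eventually_left_inverse] with t ht ht'
    rw [← ht]
    exact congrArg Ψ ht'.symm
  exact ⟨L' v, (hd2.congr_of_eventuallyEq heq).unique hd⟩

lemma IsC1Chart.finrank_tangentSpaceAt [FiniteDimensional ℝ F] (h : IsC1Chart n Sig Ω Ψ) (hx : x ∈ Ω) :
    Module.finrank ℝ (tangentSpaceAt Sig (Ψ x)) = n := by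
  rw [h.tangentSpaceAt_eq hx, LinearMap.finrank_range_of_inj (h.2.2.1 x hx),
    finrank_euclideanSpace_fin]

end Tangent

/-! ### Simple multivectors -/

section Exterior

variable {k V : Type*} [Field k] [AddCommGroup V] [Module k V] {n : ℕ}

/-- Among the independent wedges of `n`-element subfamilies of `v`, the one for the full index set
is the wedge of `v` itself. -/
lemma exteriorPower.ιMulti_ne_zero {v : Fin n → V} (hv : LinearIndependent k v) :
    exteriorPower.ιMulti k n v ≠ 0 := by
  have h := (exteriorPower.ιMulti_family_linearIndependent_field (n := n) hv).ne_zero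
    (Set.powersetCard.ofFinEmbEquiv (RelEmbedding.refl _))
  rwa [exteriorPower.ιMulti_family, Equiv.symm_apply_apply] at h

lemma mem_span_of_ι_mul_ιMulti_eq_zero {v : Fin n → V} (hv : LinearIndependent k v) {x : V}
    (h : ExteriorAlgebra.ι k x * (exteriorPower.ιMulti k n v : ExteriorAlgebra k V) = 0) :
    x ∈ Submodule.span k (Set.range v) := by
  by_contra hx
  refine exteriorPower.ιMulti_ne_zero (linearIndependent_finCons.2 ⟨hv, hx⟩) (Subtype.ext ?_)
  rw [exteriorPower.ιMulti_apply_coe, ExteriorAlgebra.ιMulti_succ_apply]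
  exact h

end Exterior

lemma exteriorPower.repr_ιMulti_eq_zero {k V : Type*} [Field k] [AddCommGroup V] [Module k V]
    {n : ℕ} {ι : Type*} [LinearOrder ι] (b : Module.Basis ι k V) {w : Fin n → V}
    {I : Set.powersetCard ι n} {i : ι} (hi : i ∈ I.1) (hw : ∀ j, b.repr (w j) i = 0) :
    (b.exteriorPower n).repr (exteriorPower.ιMulti k n w) I = 0 := by
  rw [exteriorPower.basis_repr_apply, exteriorPower.ιMultiDual_apply_ιMulti]
  obtain ⟨j, rfl⟩ := (Set.powersetCard.mem_range_ofFinEmbEquiv_symm_iff_mem I i).2 hi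
  -- The coordinate is an `n × n` minor, and its column for the index `i` vanishes.
  exact Matrix.det_eq_zero_of_column_eq_zero j hw

/-! ### Horizontal multivectors -/

lemma isTangentField_ιMulti {V : Type*} [NormedAddCommGroup V] [NormedSpace ℝ V] [Group V]
    {n : ℕ} {Sig : Set V} {p : V}
    (t : Module.Basis (Fin n) ℝ (tangentSpaceAt Sig p)) {w : Fin n → LieG V}
    (hwt : ∀ j, evalAt p (w j) = t j) :
    IsTangentField n Sig p (exteriorPower.ιMulti ℝ n w) := by
  refine ⟨t, ?_⟩
  rw [exteriorPower.map_apply_ιMulti]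
  exact congrArg _ (funext hwt)

namespace GradedBasis

variable {S : HomogeneousGroup G} {q : ℕ} (e : GradedBasis S q)

lemma repr_eq_zero_of_mem_layer {k : ℕ} {x : G} (hx : x ∈ S.layer k) {i : Fin q}
    (hi : e.deg i ≠ k) : e.basis.repr x i = 0 := by
  have h : e.basis.coord i ∘ₗ S.layerProj k = 0 := by
    refine e.basis.ext fun j => ?_
    by_cases hj : e.deg j = k
    · have hne : j ≠ i := fun h => hi (h ▸ hj)
      simp [S.layerProj_of_mem (hj ▸ e.mem_layer j), hne]
    · simp [S.layerProj_of_mem_ne hj (e.mem_layer j)]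
  have := LinearMap.congr_fun h x
  simpa [S.layerProj_of_mem hx] using this

/-- A basis multivector containing a factor of degree other than 1 has coordinate zero, and those
with all factors of degree 1 have total degree `n`. -/
lemma proj_ιMulti_of_horizontal {n : ℕ} {w : Fin n → LieG G} (hw : ∀ j, w j ∈ S.lieLayer 1)
    (M : ℕ) :
    e.proj M (exteriorPower.ιMulti ℝ n w) =
      if M = n then exteriorPower.ιMulti ℝ n w else 0 := by
  have hrepr : ∀ I : Set.powersetCard (Fin q) n, ∑ i ∈ I.1, e.deg i ≠ n →
      (e.frame.exteriorPower n).repr (exteriorPower.ιMulti ℝ n w) I = 0 := by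
    intro I hI
    obtain ⟨i, hi, hdi⟩ : ∃ i ∈ I.1, e.deg i ≠ 1 := by
      by_contra! h
      refine hI ?_
      rw [Finset.sum_congr rfl h, Finset.sum_const, smul_eq_mul, mul_one]
      exact I.2
    exact exteriorPower.repr_ιMulti_eq_zero e.frame hi
      fun j => e.repr_eq_zero_of_mem_layer (hw j) hdi
  unfold proj
  split_ifs with hM
  · subst hM
    refine Eq.trans (Finset.sum_congr rfl fun I _ => ?_)
      ((e.frame.exteriorPower M).sum_repr (exteriorPower.ιMulti ℝ M w))
    split_ifs with h
    · rfl
    · rw [hrepr I h, zero_smul]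
  · refine Finset.sum_eq_zero fun I _ => ?_
    split_ifs with h
    · rw [hrepr I (h ▸ hM), zero_smul]
    · rfl

/-- The horizontal left invariant frame of a tangent space that is contained in the horizontal
fiber. -/
lemma exists_horizontal_frame {n : ℕ} {Sig : Set G} {p : G}
    (hT : tangentSpaceAt Sig p ≤ S.horizontalFiber p)
    (t : Module.Basis (Fin n) ℝ (tangentSpaceAt Sig p)) :
    ∃ w : Fin n → LieG G, (∀ j, w j ∈ S.lieLayer 1) ∧ (∀ j, evalAt p (w j) = t j) ∧
      LinearIndependent ℝ w := by
  choose w hw hwt using fun j => Submodule.mem_map.1 (hT (t j).2)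
  refine ⟨w, hw, hwt, LinearIndependent.of_comp (evalAt p) ?_⟩
  have : evalAt p ∘ w = fun j => ((t j : tangentSpaceAt Sig p) : G) := funext hwt
  rw [this]
  exact t.linearIndependent.map' (tangentSpaceAt Sig p).subtype (Submodule.ker_subtype _)

lemma exists_ιMulti_of_isTangentField {n : ℕ} {Sig : Set G} {p : G}
    (hT : tangentSpaceAt Sig p ≤ S.horizontalFiber p) {ξ : ⋀[ℝ]^n (LieG G)}
    (hξ : IsTangentField n Sig p ξ) :
    ∃ w : Fin n → LieG G, (∀ j, w j ∈ S.lieLayer 1) ∧ ξ = exteriorPower.ιMulti ℝ n w := by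
  obtain ⟨t, ht⟩ := hξ
  obtain ⟨w, hw, hwt, -⟩ := exists_horizontal_frame hT t
  refine ⟨w, hw, exteriorPower.map_injective_field (f := evalAt p)
    (S.evalAt_injective p) ?_⟩
  rw [ht, exteriorPower.map_apply_ιMulti]
  exact congrArg _ (funext fun j => (hwt j).symm)

/-- The basis `t` provides a tangent field, so the set under `sSup` is `{n}` and not empty. -/
lemma pointwiseDegree_eq {n : ℕ} {Sig : Set G} {p : G}
    (hT : tangentSpaceAt Sig p ≤ S.horizontalFiber p)
    (t : Module.Basis (Fin n) ℝ (tangentSpaceAt Sig p)) :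
    e.pointwiseDegree n Sig p = n := by
  have hset : {M | ∃ ξ : ⋀[ℝ]^n (LieG G), IsTangentField n Sig p ξ ∧ e.proj M ξ ≠ 0} = {n} := by
    ext M
    constructor
    · rintro ⟨ξ, hξ, hM⟩
      obtain ⟨w, hw, rfl⟩ := exists_ιMulti_of_isTangentField hT hξ
      rw [e.proj_ιMulti_of_horizontal hw] at hM
      by_contra h
      exact hM (if_neg h)
    · rintro rfl
      obtain ⟨w, hw, hwt, hli⟩ := exists_horizontal_frame hT t
      refine ⟨_, isTangentField_ιMulti t hwt, ?_⟩
      rw [e.proj_ιMulti_of_horizontal hw, if_pos rfl]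
      exact exteriorPower.ιMulti_ne_zero hli
  rw [pointwiseDegree, hset, csSup_singleton]

lemma evalAt_mem_of_mem_lieHTangent {n : ℕ} {Sig : Set G} {p : G}
    (hT : tangentSpaceAt Sig p ≤ S.horizontalFiber p)
    (t : Module.Basis (Fin n) ℝ (tangentSpaceAt Sig p)) {X : LieG G}
    (hX : X ∈ e.lieHTangent n Sig p) :
    X ∈ S.lieLayer 1 ∧ evalAt p X ∈ tangentSpaceAt Sig p := by
  obtain ⟨w, hw, hwt, hli⟩ := exists_horizontal_frame hT t
  -- One tangent field suffices: being annihilated by its nonzero simple multivector already puts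
  -- `X` in the span of its factors.
  have h := hX _ (isTangentField_ιMulti t hwt)
  rw [e.pointwiseDegree_eq hT t, e.proj_ιMulti_of_horizontal hw, if_pos rfl] at h
  have hspan : Submodule.span ℝ (Set.range w) ≤
      S.lieLayer 1 ⊓ (tangentSpaceAt Sig p).comap (evalAt p) := by
    rw [Submodule.span_le]
    rintro _ ⟨j, rfl⟩
    refine ⟨hw j, ?_⟩
    change evalAt p (w j) ∈ tangentSpaceAt Sig p
    rw [hwt]
    exact (t j).2
  exact hspan (mem_span_of_ι_mul_ιMulti_eq_zero hli h)

lemma hTangent_eq {n : ℕ} (Sig : Set G) (p : G) :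
    e.hTangent n Sig p = {a : G | a ∈ e.lieHTangent n Sig p} := by
  ext a
  constructor
  · rintro ⟨X, hX, ha⟩
    rw [(S.isExp_iff X a).1 ha]
    exact hX
  · exact fun ha => ⟨a, ha, (S.isExp_iff a a).2 rfl⟩

end GradedBasis

/-! ### Horizontal submanifolds -/

/-- Tangent vectors of a `C^1` submanifold with horizontal tangent spaces have commuting horizontal
components. -/
lemma HomogeneousGroup.lie_layerProj_eq_zero_of_mem_tangentSpaceAt (S : HomogeneousGroup G) {n : ℕ}
    {Sig : Set G} {Ω : Set (EuclideanSpace ℝ (Fin n))} {Ψ : EuclideanSpace ℝ (Fin n) → G}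
    (h : IsC1Chart n Sig Ω Ψ) (hT : ∀ p ∈ Sig, tangentSpaceAt Sig p ≤ S.horizontalFiber p)
    {x : EuclideanSpace ℝ (Fin n)} (hx : x ∈ Ω) {v w : G} (hv : v ∈ tangentSpaceAt Sig (Ψ x))
    (hw : w ∈ tangentSpaceAt Sig (Ψ x)) :
    S.lie (S.layerProj 1 v) (S.layerProj 1 w) = 0 := by
  rw [h.tangentSpaceAt_eq hx] at hv hw
  obtain ⟨v, rfl⟩ := hv
  obtain ⟨w, rfl⟩ := hw
  let P : ℕ → G →L[ℝ] G := fun k => LinearMap.toContinuousLinearMap (S.layerProj k)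
  have hd : ∀ k, ∀ᶠ u in nhds x, HasFDerivAt (fun u => P k (Ψ u)) ((P k).comp (fderiv ℝ Ψ u)) u :=
    fun k => by
      filter_upwards [h.1.mem_nhds hx] with u hu
      exact (P k).hasFDerivAt.comp u (h.hasFDerivAt hu)
  have hcont : ContinuousAt (fun u => (P 1).comp (fderiv ℝ Ψ u)) x :=
    continuousAt_const.clm_comp ((h.contDiffAt hx).continuousAt_fderiv one_ne_zero)
  refine apply_fderiv_fderiv_eq_zero S.lie.toContinuousBilinearMapOfFiniteDimensional S.lie_self
    (inv_ne_zero two_ne_zero) (hd 1) hcont (hd 2) ?_ v w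
  filter_upwards [h.1.mem_nhds hx] with u hu v
  obtain ⟨U, -, hU⟩ := h.2.2.2.2
  obtain ⟨X, hX, hXv⟩ := hT (Ψ u) (hU.subset (Set.mem_image_of_mem Ψ hu)).1
    (h.range_fderiv_le hu ⟨v, rfl⟩)
  -- Since `X` is horizontal, comparing layers 1 and 2 of `X(Ψ u)` gives `dg = ½[f, df]` for `f =
  -- Ψ₁`, `g = Ψ₂`.
  have hX1 : S.layerProj 1 X = X := S.layerProj_of_mem hX
  have hX2 : S.layerProj 2 X = 0 := S.layerProj_of_mem_ne (by norm_num) hX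
  have h1 := S.layerProj_one_evalAt (Ψ u) X
  have h2 := S.layerProj_two_evalAt (Ψ u) X
  rw [hX2, zero_add, ← h1] at h2
  rw [hXv] at h1 h2
  exact h2

end

theorem theoremt {G : Type*} [NormedAddCommGroup G] [NormedSpace ℝ G] [FiniteDimensional ℝ G]
    [Group G] (S : HomogeneousGroup G) {q : ℕ} (e : GradedBasis S q) (n : ℕ) (Sig : Set G)
    (hSig : IsC1Submanifold n Sig)
    (hT : ∀ p ∈ Sig, tangentSpaceAt Sig p ≤ S.horizontalFiber p) :
    e.IsHorizontalSubmanifold n Sig ∧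
      ∀ p ∈ Sig, ∀ a ∈ e.hTangent n Sig p, ∀ b ∈ e.hTangent n Sig p, a * b = b * a := by
  have key : ∀ p ∈ Sig, ∀ X : G, X ∈ e.lieHTangent n Sig p → X ∈ S.layer 1 ∧
      ∀ Y : G, Y ∈ e.lieHTangent n Sig p → S.lie X Y = 0 := by
    intro p hp X hX
    obtain ⟨Ω, Ψ, hchart, x, hx, rfl⟩ := hSig p hp
    let t : Module.Basis (Fin n) ℝ (tangentSpaceAt Sig (Ψ x)) :=
      Module.finBasisOfFinrankEq ℝ _ (hchart.finrank_tangentSpaceAt hx)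
    obtain ⟨hX1, hXT⟩ := e.evalAt_mem_of_mem_lieHTangent (hT _ hp) t hX
    refine ⟨hX1, fun Y hY => ?_⟩
    obtain ⟨hY1, hYT⟩ := e.evalAt_mem_of_mem_lieHTangent (hT _ hp) t hY
    have h := S.lie_layerProj_eq_zero_of_mem_tangentSpaceAt hchart hT hx hXT hYT
    -- The first layer of `X(p)` is `X` itself, so the relation between tangent vectors becomes `[X,
    -- Y] = 0` at the unit.
    rwa [S.layerProj_one_evalAt, S.layerProj_one_evalAt, S.layerProj_of_mem hX1,
      S.layerProj_of_mem hY1] at h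
  have hmul : ∀ p ∈ Sig, ∀ X : G, X ∈ e.lieHTangent n Sig p →
      ∀ Y : G, Y ∈ e.lieHTangent n Sig p → X * Y = X + Y := fun p hp X hX Y hY =>
    S.mul_of_commute ((key p hp X hX).2 Y hY)
  refine ⟨⟨hSig, fun p hp => ⟨hp, ?_, ?_, ?_⟩⟩, ?_⟩
  · intro X hX Y hY
    rw [S.bracket_eq_zero_of_commute ((key p hp X hX).2 Y hY)]
    exact zero_mem _
  · rw [e.hTangent_eq]
    refine ⟨e.lieHTangent n Sig p, rfl, fun r _ x hx => ?_, ?_⟩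
    · rw [S.dilation_of_mem_layer_one r (key p hp x hx).1]
      exact Submodule.smul_mem (e.lieHTangent n Sig p) r hx
    · refine ⟨{
        carrier := {a : G | a ∈ e.lieHTangent n Sig p}
        mul_mem' := ?_
        one_mem' := ?_
        inv_mem' := ?_ }, rfl⟩
      · intro a b ha hb
        change a * b ∈ e.lieHTangent n Sig p
        rw [hmul p hp a ha b hb]
        exact Submodule.add_mem (e.lieHTangent n Sig p) ha hb
      · change (1 : G) ∈ e.lieHTangent n Sig p
        rw [S.one_eq_zero]
        exact Submodule.zero_mem (e.lieHTangent n Sig p)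
      · intro a ha
        have hna : -a ∈ e.lieHTangent n Sig p :=
          Submodule.neg_mem (e.lieHTangent n Sig p) ha
        have hinv : a⁻¹ = -a := by
          rw [inv_eq_iff_mul_eq_one, hmul p hp a ha (-a) hna, add_neg_cancel, S.one_eq_zero]
        change a⁻¹ ∈ e.lieHTangent n Sig p
        rw [hinv]
        exact hna
  · rw [e.hTangent_eq]
    exact fun a ha => (key p hp a ha).1
  · intro p hp a ha b hb
    rw [e.hTangent_eq] at ha hb
    rw [hmul p hp a ha b hb, hmul p hp b hb a ha, add_comm]
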